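/- Consider an urn with $w$ white and $b$ black balls that evolves as follows. At each time $1,2,3,\dots$ a ball is drawn uniformly at random (independently of the past), its colour is observed and it is put back; if it is white, one black ball is replaced by a white one, and if it is black, one white ball is replaced by a black one. The process stops as soon as all balls in the urn have the same colour. The urn is controlled by Policy A: at time $0$ and immediately after each draw (with its replacement), if the number of white balls is greater than or equal to the number of black balls, white balls are removed so that their number becomes one less than the number of black balls; otherwise nothing is done. Let $(W_n,B_n)$ be the numbers of white and black balls after $n$ draws and after the corresponding intervention of Policy A, let $H=\min\{n\ge 0: W_n=0 \text{ or } B_n=0\}$ be the absorption time, and let $T^A(w,b)$ be the expectation of $H$ when the urn initially (before the intervention at time $0$) contains $w$ white and $b$ black balls. Then $T^A(k,k)$ is finite for every integer $k\ge 1$, and, as $k\to\infty$, $$T^A(k,k)-\left(\left(\frac{k}{2}+\frac{\pi}{16}-\frac{\sqrt{\pi k}}{4}\right)\left(\ln k+\ln 4+\gamma\right)+\frac{3\pi}{16}-\frac{\sqrt{\pi k}}{4}-\frac14\right)\to 0,$$ where $\gamma=0.5772\dots$ is the Euler–Mascheroni constant. -/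

import Mathlib

open MeasureTheory ProbabilityTheory Filter Topology
open scoped ENNReal

namespace Mabinogion

/-- The contents of the urn: `(w, b)` stands for `w` white and `b` black balls. -/
abbrev State : Type := ℕ × ℕ

/-- All remaining balls are of the same colour. -/
def Absorbed (s : State) : Prop := s.1 = 0 ∨ s.2 = 0

instance (s : State) : Decidable (Absorbed s) := by
  unfold Absorbed; infer_instance

/-- The intervention of Policy A: if there are at least as many white balls as black ones,
reduce the number of white balls to one less than the number of black balls; otherwise do
nothing. (With no black balls at all, every white ball is removed; this case never occurs when
there is a black ball initially.) -/
def policyA (s : State) : State := if s.2 ≤ s.1 then (s.2 - 1, s.2) else s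

/-- One transition of the controlled urn: nothing happens once the urn is absorbed; otherwise a
uniformly random ball is drawn, a ball of the other colour is replaced by one of the colour
drawn, and then Policy A is applied. -/
noncomputable def stepMeasure (s : State) : Measure State :=
  if Absorbed s then Measure.dirac s
  else ((s.1 : ℝ≥0∞) / (s.1 + s.2)) • Measure.dirac (policyA (s.1 + 1, s.2 - 1)) +
    ((s.2 : ℝ≥0∞) / (s.1 + s.2)) • Measure.dirac (policyA (s.1 - 1, s.2 + 1))

instance (s : State) : IsProbabilityMeasure (stepMeasure s) := by
  unfold stepMeasure
  split_ifs with h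
  · infer_instance
  · constructor
    have h0 : (s.1 : ℝ≥0∞) + s.2 ≠ 0 := by
      unfold Absorbed at h
      push Not at h
      simp [h.1]
    have ht : (s.1 : ℝ≥0∞) + s.2 ≠ ∞ := by simp
    simp only [Measure.coe_add, Measure.coe_smul, Pi.add_apply, Pi.smul_apply, measure_univ,
      smul_eq_mul, mul_one]
    rw [← ENNReal.add_div, ENNReal.div_self h0 ht]

/-- The transition kernel of the controlled urn. -/
noncomputable def stepKernel : Kernel State State where
  toFun := stepMeasure
  measurable' := measurable_of_countable _

instance : IsMarkovKernel stepKernel := ⟨fun s => inferInstanceAs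
  (IsProbabilityMeasure (stepMeasure s))⟩

/-- The law of the next state given the history up to time `n`: it depends only on the state at
time `n`. -/
noncomputable def historyKernel (n : ℕ) : Kernel ((_ : Finset.Iic n) → State) State :=
  stepKernel.comap (fun h => h ⟨n, Finset.mem_Iic.2 le_rfl⟩) (measurable_pi_apply _)

instance (n : ℕ) : IsMarkovKernel (historyKernel n) := by
  unfold historyKernel; infer_instance

/-- The law, on the space of trajectories, of the urn process controlled by Policy A and started
from `w` white and `b` black balls. Policy A is applied at time `0` too, so the time-`0` state of
the trajectory is `policyA (w, b)`. -/
noncomputable def lawA (w b : ℕ) : Measure (ℕ → State) :=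
  Kernel.traj (X := fun _ => State) historyKernel 0 (fun _ => policyA (w, b))

/-- The absorption time `H = min {n | Wₙ = 0 or Bₙ = 0}` of a trajectory (`⊤` if it is never
absorbed). -/
noncomputable def absorptionTime (x : ℕ → State) : ℕ∞ :=
  ⨅ (n : ℕ) (_ : Absorbed (x n)), (n : ℕ∞)

/-- The expected absorption time under Policy A, as an extended nonnegative real. -/
noncomputable def TA (w b : ℕ) : ℝ≥0∞ :=
  ∫⁻ x, (absorptionTime x : ℝ≥0∞) ∂(lawA w b)

end Mabinogion

namespace Mabinogion

/-! Started from `k = n + 1` balls of each colour, Policy A moves to `n` white and `n + 1` black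
balls. The total stays equal to `2 * n + 1` until `n + 1` white balls are reached; the policy then
drops to `n - 1` white and `n` black balls, the same situation one level down. So on one level the
expected time solves a linear second-order difference equation in the number of white balls, with
value `0` at `0` and `tau (n - 1)` at `n + 1`. The increments of the homogeneous solution are the
binomials `(2 * n).choose w`, and variation of constants gives `levelValue`.

Evaluating it at `n` (`levelValue_self`) requires one binomial identity, `sum_chooseSum_betaWeight`,
and gives the recursion `tau_succ`: `tau (n + 1)` is the average of `tau n` and `(n + 3/2) *
oddHarmonic (n + 1)`, the latter with weight `2 / (1 + invReturn (n + 1))`. `TA_eq_of_first_step`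
identifies `tau` with the expected absorption time.

For the asymptotics, `tauApprox` satisfies the recursion up to a defect tending to `0`. The weights
have divergent sum, so averaging forces `tau - tauApprox` to `0` (`tendsto_zero_of_average`). Wallis
bounds on `invReturn` and a second-order estimate of `oddHarmonic` turn `tauApprox` into the stated
expansion. -/

/-! ### First-step analysis for the trajectory law -/

/-- The indicator of the states that are not absorbed. -/
noncomputable def alive (s : State) : ℝ≥0∞ := if Absorbed s then 0 else 1

lemma alive_of_absorbed {s : State} (h : Absorbed s) : alive s = 0 := if_pos h

lemma alive_of_not_absorbed {s : State} (h : ¬ Absorbed s) : alive s = 1 := if_neg h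

/-- Along a trajectory that stays absorbed once it is absorbed, the absorption time counts the
times at which the urn is not absorbed. -/
lemma absorptionTime_eq_tsum {x : ℕ → State} (h : ∀ n, Absorbed (x n) → Absorbed (x (n + 1))) :
    (absorptionTime x : ℝ≥0∞) = ∑' n, alive (x n) := by
  classical
  by_cases hex : ∃ n, Absorbed (x n)
  · have hle : ∀ n, Nat.find hex ≤ n → Absorbed (x n) := fun n hn => by
      induction n, hn using Nat.le_induction with
      | base => exact Nat.find_spec hex
      | succ m _ ih => exact h m ih
    have hH : absorptionTime x = (Nat.find hex : ℕ∞) := by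
      refine le_antisymm (iInf₂_le (Nat.find hex) (Nat.find_spec hex)) (le_iInf₂ fun n hn => ?_)
      exact_mod_cast Nat.find_min' hex hn
    rw [hH, ENat.toENNReal_coe, tsum_eq_sum (s := Finset.range (Nat.find hex))]
    · rw [Finset.sum_congr rfl fun n hn => alive_of_not_absorbed
        (Nat.find_min hex (Finset.mem_range.1 hn))]
      simp
    · intro n hn
      exact alive_of_absorbed (hle n (by simpa using hn))
  · push Not at hex
    have hH : absorptionTime x = ⊤ := by
      simp [absorptionTime, hex]
    rw [hH, ENat.toENNReal_top, tsum_congr fun n => alive_of_not_absorbed (hex n)]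
    exact (ENNReal.tsum_const_eq_top_of_ne_zero one_ne_zero).symm

instance (w b : ℕ) : IsProbabilityMeasure (lawA w b) := by
  unfold lawA; infer_instance

lemma lintegral_lawA_zero (w b : ℕ) (f : State → ℝ≥0∞) :
    ∫⁻ x, f (x 0) ∂lawA w b = f (policyA (w, b)) := by
  have hf : Measurable f := measurable_of_countable _
  unfold lawA
  rw [Kernel.lintegral_traj _ (by fun_prop)]
  simp [Function.updateFinset]

/-- The Markov property for one step. -/
lemma lintegral_lawA_succ (w b n : ℕ) (f : State → State → ℝ≥0∞) :
    ∫⁻ x, f (x n) (x (n + 1)) ∂lawA w b = ∫⁻ x, ∫⁻ y, f (x n) y ∂stepMeasure (x n) ∂lawA w b := by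
  have hf : Measurable (Function.uncurry f) := measurable_of_countable _
  have hg : Measurable fun s : State => ∫⁻ y, f s y ∂stepMeasure s := measurable_of_countable _
  unfold lawA
  set x₀ : (_ : Finset.Iic 0) → State := fun _ => policyA (w, b)
  have hmap := Kernel.partialTraj_compProd_eq_map_traj (X := fun _ => State)
    (κ := historyKernel) (Nat.zero_le n) (x₀ := x₀)
  let F : ((_ : Finset.Iic n) → State) × State → ℝ≥0∞ :=
    fun p => f (p.1 ⟨n, Finset.mem_Iic.2 le_rfl⟩) p.2
  have hF : Measurable F := by
    change Measurable (Function.uncurry f ∘ fun p : ((_ : Finset.Iic n) → State) × State =>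
      (p.1 ⟨n, Finset.mem_Iic.2 le_rfl⟩, p.2))
    exact hf.comp (by fun_prop)
  -- The history up to time `n` paired with the next state has law `partialTraj` composed with
  -- `historyKernel n`.
  calc _ = ∫⁻ p, F p ∂(Kernel.traj (X := fun _ => State) historyKernel 0 x₀).map
        (fun x => (Preorder.frestrictLe n x, x (n + 1))) := by
        rw [lintegral_map hF (by fun_prop)]; rfl
    _ = ∫⁻ h, ∫⁻ y, f (h ⟨n, Finset.mem_Iic.2 le_rfl⟩) y
          ∂stepMeasure (h ⟨n, Finset.mem_Iic.2 le_rfl⟩)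
          ∂Kernel.partialTraj (X := fun _ => State) historyKernel 0 n x₀ := by
        rw [← hmap, Measure.lintegral_compProd hF]; rfl
    _ = _ := by
        rw [← Kernel.traj_map_frestrictLe_apply, lintegral_map _ (by fun_prop)]
        · rfl
        · exact hg.comp (measurable_pi_apply _)

lemma ae_lawA_succ {w b n : ℕ} {p : State → State → Prop}
    (h : ∀ᵐ x ∂lawA w b, ∀ᵐ y ∂stepMeasure (x n), p (x n) y) :
    ∀ᵐ x ∂lawA w b, p (x n) (x (n + 1)) := by
  classical
  have key := lintegral_lawA_succ w b n fun s y => if p s y then 0 else 1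
  have hm : Measurable fun x : ℕ → State => if p (x n) (x (n + 1)) then (0 : ℝ≥0∞) else 1 :=
    (measurable_of_countable fun q : State × State => if p q.1 q.2 then (0 : ℝ≥0∞) else 1).comp
      (by fun_prop : Measurable fun x : ℕ → State => (x n, x (n + 1)))
  have hzero : ∫⁻ x, ∫⁻ y, (if p (x n) y then 0 else 1) ∂stepMeasure (x n) ∂lawA w b = 0 := by
    rw [← lintegral_zero (μ := lawA w b)]
    refine lintegral_congr_ae ?_
    filter_upwards [h] with x hx
    rw [← lintegral_zero (μ := stepMeasure (x n))]
    refine lintegral_congr_ae ?_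
    filter_upwards [hx] with y hy
    simp [hy]
  rw [hzero, lintegral_eq_zero_iff hm] at key
  filter_upwards [key] with x hx
  by_contra hp
  simp [hp] at hx

lemma ae_lawA_mem {w b : ℕ} {R : Set State} (h0 : policyA (w, b) ∈ R)
    (hR : ∀ s ∈ R, ∀ᵐ y ∂stepMeasure s, y ∈ R) (n : ℕ) : ∀ᵐ x ∂lawA w b, x n ∈ R := by
  classical
  induction n with
  | zero =>
    have key := lintegral_lawA_zero w b fun s => if s ∈ R then 0 else 1
    have hm : Measurable fun x : ℕ → State => if x 0 ∈ R then (0 : ℝ≥0∞) else 1 :=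
      (measurable_of_countable fun s : State => if s ∈ R then (0 : ℝ≥0∞) else 1).comp
        (measurable_pi_apply 0)
    rw [if_pos h0, lintegral_eq_zero_iff hm] at key
    filter_upwards [key] with x hx
    by_contra hp
    simp [hp] at hx
  | succ n ih =>
    refine ae_lawA_succ (p := fun _ y => y ∈ R) ?_
    filter_upwards [ih] with x hx using hR _ hx

lemma ae_lawA_absorbed (w b : ℕ) :
    ∀ᵐ x ∂lawA w b, ∀ n, Absorbed (x n) → Absorbed (x (n + 1)) := by
  rw [ae_all_iff]
  intro n
  refine ae_lawA_succ (p := fun s y => Absorbed s → Absorbed y) (ae_of_all _ fun x => ?_)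
  by_cases hx : Absorbed (x n)
  · rw [stepMeasure, if_pos hx]
    filter_upwards [ae_eq_dirac (fun y : State => y)] with y hy _
    rw [hy]; exact hx
  · exact ae_of_all _ fun y hy => absurd hy hx

lemma measurable_alive_eval (n : ℕ) : Measurable fun x : ℕ → State => alive (x n) :=
  (measurable_of_countable alive).comp (measurable_pi_apply n)

lemma TA_eq_tsum (w b : ℕ) : TA w b = ∑' n, ∫⁻ x, alive (x n) ∂lawA w b := by
  rw [← lintegral_tsum fun n => (measurable_alive_eval n).aemeasurable]
  refine lintegral_congr_ae ?_
  filter_upwards [ae_lawA_absorbed w b] with x hx using absorptionTime_eq_tsum hx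

/-- First-step analysis: a function which satisfies the first-step equation on an invariant set and
which is bounded there and vanishes at the absorbed states is the expected absorption time. -/
theorem TA_eq_of_first_step {w b : ℕ} {R : Set State} {V : State → ℝ≥0∞} {M : ℝ≥0∞}
    (hM : M ≠ ∞) (h0 : policyA (w, b) ∈ R) (hR : ∀ s ∈ R, ∀ᵐ y ∂stepMeasure s, y ∈ R)
    (hV : ∀ s ∈ R, V s = alive s + ∫⁻ y, V y ∂stepMeasure s)
    (hVM : ∀ s ∈ R, V s ≤ M * alive s) : TA w b = V (policyA (w, b)) := by
  set a : ℕ → ℝ≥0∞ := fun n => ∫⁻ x, alive (x n) ∂lawA w b with ha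
  set v : ℕ → ℝ≥0∞ := fun n => ∫⁻ x, V (x n) ∂lawA w b with hv
  have hv0 : v 0 = V (policyA (w, b)) := lintegral_lawA_zero w b V
  have hstep : ∀ n, v n = a n + v (n + 1) := fun n => by
    have h1 : v (n + 1) = ∫⁻ x, ∫⁻ y, V y ∂stepMeasure (x n) ∂lawA w b :=
      lintegral_lawA_succ w b n fun _ y => V y
    rw [h1]
    simp only [ha, hv]
    rw [← lintegral_add_left (measurable_alive_eval n)]
    refine lintegral_congr_ae ?_
    filter_upwards [ae_lawA_mem h0 hR n] with x hx using hV _ hx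
  have hbound : ∀ n, v n ≤ M * a n := fun n => by
    simp only [ha, hv]
    rw [← lintegral_const_mul _ (measurable_alive_eval n)]
    refine lintegral_mono_ae ?_
    filter_upwards [ae_lawA_mem h0 hR n] with x hx using hVM _ hx
  have hsum : ∀ n, v 0 = ∑ i ∈ Finset.range n, a i + v n := fun n => by
    induction n with
    | zero => simp
    | succ n ih => rw [Finset.sum_range_succ, add_assoc, ← hstep, ← ih]
  have hfin : v 0 ≠ ∞ := by
    rw [hv0]
    refine ne_top_of_le_ne_top ?_ (hVM _ h0)
    refine ENNReal.mul_ne_top hM ?_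
    unfold alive; split_ifs <;> simp
  -- Finiteness of `v 0` makes `a` summable, so `a n → 0`, and `v n ≤ M * a n` kills the remainder
  -- in `hsum`. Almost sure absorption need not be known beforehand.
  have hle : ∑' n, a n ≤ v 0 := by
    rw [ENNReal.tsum_eq_iSup_nat]
    exact iSup_le fun n => by rw [hsum n]; exact le_self_add
  have hlim : Tendsto a atTop (𝓝 0) :=
    ENNReal.tendsto_atTop_zero_of_tsum_ne_top (ne_top_of_le_ne_top hfin hle)
  have hvlim : Tendsto v atTop (𝓝 0) := by
    refine tendsto_of_tendsto_of_tendsto_of_le_of_le tendsto_const_nhds ?_ (fun _ => zero_le)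
      hbound
    simpa using ENNReal.Tendsto.const_mul hlim (Or.inr hM)
  have hconv := (ENNReal.tendsto_nat_tsum a).add hvlim
  rw [add_zero, ← funext hsum] at hconv
  rw [TA_eq_tsum, ← hv0]
  exact tendsto_nhds_unique hconv tendsto_const_nhds

/-! ### Binomial sums against Beta weights -/

/-- The partial row sums of Pascal's triangle. -/
noncomputable def chooseSum (M j : ℕ) : ℝ := ∑ i ∈ Finset.range j, (M.choose i : ℝ)

/-- The value `j! (M - 1 - j)! / M!` of the Beta integral `∫ x ^ j (1 - x) ^ (M - 1 - j)`. -/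
noncomputable def betaWeight (M j : ℕ) : ℝ :=
  (j.factorial * (M - 1 - j).factorial : ℝ) / M.factorial

/-- The sum of the reciprocals of the first `n` odd numbers. -/
noncomputable def oddHarmonic (n : ℕ) : ℝ := ∑ i ∈ Finset.range n, 1 / (2 * (i : ℝ) + 1)

/-- The reciprocal `4 ^ n / (2 * n).choose n` of the return probability of a simple random walk. -/
noncomputable def invReturn (n : ℕ) : ℝ := 4 ^ n / ((2 * n).choose n : ℝ)

lemma chooseSum_succ (M j : ℕ) : chooseSum M (j + 1) = chooseSum M j + M.choose j :=
  Finset.sum_range_succ _ _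

lemma chooseSum_succ_succ (M j : ℕ) :
    chooseSum (M + 1) (j + 1) = chooseSum M (j + 1) + chooseSum M j := by
  induction j with
  | zero => simp [chooseSum]
  | succ j ih =>
    rw [chooseSum_succ, ih, chooseSum_succ M (j + 1), chooseSum_succ M j, Nat.choose_succ_succ]
    push_cast; ring

lemma betaWeight_pos (M j : ℕ) : 0 < betaWeight M j := by
  unfold betaWeight; positivity

lemma betaWeight_add (a b : ℕ) :
    betaWeight (a + b + 1) a = (a.factorial * b.factorial : ℝ) / (a + b + 1).factorial := by
  rw [betaWeight, show a + b + 1 - 1 - a = b by omega]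

/-- This is `1 = (1 - x) + x` under the Beta integral. -/
lemma betaWeight_eq_add {M j : ℕ} (h : j < M) :
    betaWeight M j = betaWeight (M + 1) j + betaWeight (M + 1) (j + 1) := by
  obtain ⟨b, rfl⟩ : ∃ b, M = j + b + 1 := ⟨M - j - 1, by omega⟩
  rw [betaWeight_add, show j + b + 1 + 1 = j + (b + 1) + 1 by ring, betaWeight_add,
    show j + (b + 1) + 1 = (j + 1) + b + 1 by ring, betaWeight_add]
  have h1 : ((j + 1 + b + 1).factorial : ℝ) = (j + b + 2) * (j + b + 1).factorial := by
    rw [show j + 1 + b + 1 = (j + b + 1) + 1 by ring, Nat.factorial_succ]; push_cast; ring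
  have h2 : ((j + b + 1).factorial : ℝ) ≠ 0 := by positivity
  rw [h1, Nat.factorial_succ j, Nat.factorial_succ b]
  field_simp
  push_cast
  ring

/-- Pascal's rule for the partial sums and the splitting of the weights match up, so passing from
row `M` to row `M + 1` costs only a boundary term. -/
lemma sum_chooseSum_betaWeight_succ {M m : ℕ} (h : m ≤ M) :
    ∑ j ∈ Finset.range m, chooseSum M (j + 1) * betaWeight M j =
      ∑ j ∈ Finset.range m, chooseSum (M + 1) (j + 1) * betaWeight (M + 1) j +
        chooseSum M m * betaWeight (M + 1) m := by
  induction m with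
  | zero => simp [chooseSum]
  | succ m ih =>
    rw [Finset.sum_range_succ, Finset.sum_range_succ, ih (by omega),
      betaWeight_eq_add (show m < M by omega), chooseSum_succ_succ]
    ring

/-- Two passages lead from row `2 * n` to row `2 * n + 2`. Their boundary terms and the new summand
`j = n` combine to `1 / (2 * (2 * n + 1))`, half the next term of `oddHarmonic`. -/
theorem sum_chooseSum_betaWeight (n : ℕ) :
    ∑ j ∈ Finset.range n, chooseSum (2 * n) (j + 1) * betaWeight (2 * n) j = oddHarmonic n / 2 := by
  induction n with
  | zero => simp [oddHarmonic]
  | succ n ih =>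
    have h1 := sum_chooseSum_betaWeight_succ (show n ≤ 2 * n by omega)
    have h2 := sum_chooseSum_betaWeight_succ (show n ≤ 2 * n + 1 by omega)
    have hw : betaWeight (2 * n + 1) n = 2 * betaWeight (2 * n + 2) n := by
      rw [show 2 * n + 2 = n + (n + 1) + 1 by ring, betaWeight_add,
        show 2 * n + 1 = n + n + 1 by ring, betaWeight_add,
        show n + (n + 1) + 1 = (n + n + 1) + 1 by ring, Nat.factorial_succ (n + n + 1),
        Nat.factorial_succ n]
      have : ((n + n + 1).factorial : ℝ) ≠ 0 := by positivity
      field_simp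
      push_cast
      ring
    have hc : betaWeight (2 * n + 2) n * ((2 * n).choose n : ℝ) = 1 / (2 * (2 * n + 1)) := by
      rw [show 2 * n + 2 = n + (n + 1) + 1 by ring, betaWeight_add, two_mul n,
        Nat.cast_add_choose,
        show n + (n + 1) + 1 = (n + n) + 1 + 1 by ring, Nat.factorial_succ (n + n + 1),
        Nat.factorial_succ (n + n), Nat.factorial_succ n]
      have : ((n + n).factorial : ℝ) ≠ 0 := by positivity
      push_cast
      field_simp
      ring
    have h3 := chooseSum_succ_succ (2 * n + 1) n
    have h4 := chooseSum_succ_succ (2 * n) n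
    have h5 := chooseSum_succ (2 * n) n
    have h6 : oddHarmonic (n + 1) = oddHarmonic n + 1 / (2 * n + 1) := Finset.sum_range_succ _ _
    have hhalf : (1 : ℝ) / (2 * (2 * n + 1)) = 1 / (2 * n + 1) / 2 := by
      field_simp
    rw [show 2 * (n + 1) = 2 * n + 2 by ring, Finset.sum_range_succ, h6]
    rw [show 2 * n + 1 + 1 = 2 * n + 2 by ring] at *
    rw [h3, h4, h5]
    rw [ih, hw] at h1
    linear_combination -h1 - h2 + hc + hhalf

lemma chooseSum_half (n : ℕ) :
    2 * chooseSum (2 * n) (n + 1) = 4 ^ n + ((2 * n).choose n : ℝ) := by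
  have h1 : chooseSum (2 * n + 1) (n + 1) = 4 ^ n := by
    unfold chooseSum
    exact_mod_cast Nat.sum_range_choose_halfway n
  have h2 := chooseSum_succ_succ (2 * n) n
  have h3 := chooseSum_succ (2 * n) n
  linarith

lemma chooseSum_half_pos (n : ℕ) : 0 < chooseSum (2 * n) (n + 1) := by
  have := chooseSum_half n
  have : (0 : ℝ) < 4 ^ n := by positivity
  have : (0 : ℝ) ≤ ((2 * n).choose n : ℝ) := by positivity
  linarith

/-- Abel summation; the term `i = m` on the left vanishes. -/
lemma sum_mul_sub_partialSum (c w : ℕ → ℝ) (m : ℕ) :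
    ∑ i ∈ Finset.range (m + 1),
        c i * (∑ j ∈ Finset.range m, w j - ∑ j ∈ Finset.range i, w j) =
      ∑ j ∈ Finset.range m, (∑ i ∈ Finset.range (j + 1), c i) * w j := by
  induction m with
  | zero => simp
  | succ m ih =>
    rw [Finset.sum_range_succ (fun j => (∑ i ∈ Finset.range (j + 1), c i) * w j) m, ← ih,
      Finset.sum_range_succ _ (m + 1), sub_self, mul_zero,
      add_zero, Finset.sum_mul, ← Finset.sum_add_distrib]
    refine Finset.sum_congr rfl fun i _ => ?_
    rw [Finset.sum_range_succ w m]
    ring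

/-! ### The difference equation on one level -/

/-- The source term of the first-step equation, divided by the increments of the harmonic
function. -/
noncomputable def source (n i : ℕ) : ℝ :=
  (2 * n + 1) * ∑ j ∈ Finset.range i, betaWeight (2 * n) j

/-- The initial slope of the solution of the first-step equation with value `t` at `n + 1`. -/
noncomputable def slope (n : ℕ) (t : ℝ) : ℝ :=
  (t + ∑ i ∈ Finset.range (n + 1), ((2 * n).choose i : ℝ) * source n i) / chooseSum (2 * n) (n + 1)

/-- The expected absorption time of an urn of `2 * n + 1` balls, `w` of them white, which collects
an extra time `t` when it reaches `n + 1` white balls. -/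
noncomputable def levelValue (n : ℕ) (t : ℝ) (w : ℕ) : ℝ :=
  ∑ i ∈ Finset.range w, ((2 * n).choose i : ℝ) * (slope n t - source n i)

lemma levelValue_zero (n : ℕ) (t : ℝ) : levelValue n t 0 = 0 := rfl

lemma levelValue_succ (n : ℕ) (t : ℝ) (w : ℕ) :
    levelValue n t (w + 1) =
      levelValue n t w + ((2 * n).choose w : ℝ) * (slope n t - source n w) :=
  Finset.sum_range_succ _ _

lemma levelValue_top (n : ℕ) (t : ℝ) : levelValue n t (n + 1) = t := by
  have h := (chooseSum_half_pos n).ne'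
  simp only [levelValue, mul_sub, Finset.sum_sub_distrib]
  rw [← Finset.sum_mul]
  change chooseSum (2 * n) (n + 1) * _ - _ = _
  rw [slope, mul_div_cancel₀ _ h]
  ring

lemma source_succ (n i : ℕ) :
    source n (i + 1) = source n i + (2 * n + 1) * betaWeight (2 * n) i := by
  rw [source, Finset.sum_range_succ, mul_add, ← source]

lemma source_mono (n : ℕ) : Monotone (source n) :=
  monotone_nat_of_le_succ fun i => by
    rw [source_succ]
    have := betaWeight_pos (2 * n) i
    have : (0 : ℝ) ≤ (2 * n + 1) * betaWeight (2 * n) i := by positivity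
    linarith

/-- As `source` is monotone, the increments change sign at most once, from nonnegative to
nonpositive. The values therefore stay above the smaller of the end values `0` and `t`. -/
lemma levelValue_nonneg {n : ℕ} {t : ℝ} (ht : 0 ≤ t) {w : ℕ} (hw : w ≤ n + 1) :
    0 ≤ levelValue n t w := by
  rcases le_total (source n w) (slope n t) with h | h
  · refine Finset.sum_nonneg fun i hi => mul_nonneg (by positivity) ?_
    have := source_mono n (Finset.mem_range.1 hi).le
    linarith
  · have htop := levelValue_top n t
    rw [levelValue, ← Finset.sum_range_add_sum_Ico _ hw, ← levelValue] at htop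
    have : ∑ i ∈ Finset.Ico w (n + 1), ((2 * n).choose i : ℝ) * (slope n t - source n i) ≤ 0 := by
      refine Finset.sum_nonpos fun i hi => mul_nonpos_of_nonneg_of_nonpos (by positivity) ?_
      have := source_mono n (Finset.mem_Ico.1 hi).1
      linarith
    linarith

lemma levelValue_first_step {n v b : ℕ} (hb : v + 1 + b = 2 * n + 1) (hv : v < n) (t : ℝ) :
    (2 * n + 1) * levelValue n t (v + 1) =
      (2 * n + 1) + (v + 1) * levelValue n t (v + 2) + b * levelValue n t v := by
  have hbR : (b : ℝ) = 2 * n - v := by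
    have : ((v + 1 + b : ℕ) : ℝ) = (2 * n + 1 : ℕ) := by rw [hb]
    push_cast at this; linarith
  -- `hc` says that binomial increments solve the homogeneous equation; `hw` says that the increment
  -- of `source` produces exactly the inhomogeneous term.
  have hc : ((v : ℝ) + 1) * ((2 * n).choose (v + 1) : ℝ) = b * ((2 * n).choose v : ℝ) := by
    have := Nat.choose_succ_right_eq (2 * n) v
    rw [show 2 * n - v = b by omega] at this
    have h2 : (((2 * n).choose (v + 1) * (v + 1) : ℕ) : ℝ) = ((2 * n).choose v * b : ℕ) := by
      rw [this]
    push_cast at h2; linarith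
  have hw : (b : ℝ) * ((2 * n).choose v : ℝ) * betaWeight (2 * n) v = 1 := by
    obtain ⟨c, rfl⟩ : ∃ c, b = c + 1 := ⟨b - 1, by omega⟩
    rw [show 2 * n = v + (c + 1) by omega, Nat.cast_add_choose,
      show v + (c + 1) = v + c + 1 by ring, betaWeight_add, Nat.factorial_succ c]
    push_cast
    field_simp
  rw [show v + 2 = (v + 1) + 1 by ring, levelValue_succ n t (v + 1), levelValue_succ n t v,
    source_succ]
  rw [mul_add ((v : ℝ) + 1), ← mul_assoc ((v : ℝ) + 1), hc, hbR] at *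
  linear_combination (2 * n + 1 : ℝ) * hw

/-- Going back one step from the boundary value `t` subtracts the last increment. The weight is the
ratio of the central binomial to the half row sum, and the sum left over is the Abel-summed form of
`sum_chooseSum_betaWeight`. -/
lemma levelValue_self (n : ℕ) (t : ℝ) :
    levelValue n t n = t + 2 / (1 + invReturn n) * ((n + 1 / 2) * oddHarmonic n - t) := by
  have hC : (0 : ℝ) < ((2 * n).choose n : ℝ) := by
    exact_mod_cast Nat.choose_pos (by omega)
  have hH := chooseSum_half_pos n
  have hq : 2 / (1 + invReturn n) = ((2 * n).choose n : ℝ) / chooseSum (2 * n) (n + 1) := by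
    have h4 := chooseSum_half n
    have : (0 : ℝ) < 4 ^ n := by positivity
    rw [invReturn, div_eq_div_iff (by positivity) hH.ne']
    field_simp
    linarith
  have hS : (n + 1 / 2) * oddHarmonic n =
      ∑ i ∈ Finset.range (n + 1), ((2 * n).choose i : ℝ) * (source n n - source n i) := by
    have h1 := sum_mul_sub_partialSum (fun i => ((2 * n).choose i : ℝ)) (betaWeight (2 * n)) n
    have h2 := sum_chooseSum_betaWeight n
    unfold chooseSum at h2
    rw [h2] at h1
    have h3 : ∑ i ∈ Finset.range (n + 1), ((2 * n).choose i : ℝ) * (source n n - source n i) =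
        (2 * n + 1) * (oddHarmonic n / 2) := by
      rw [← h1, Finset.mul_sum]
      refine Finset.sum_congr rfl fun i _ => ?_
      simp only [source]; ring
    rw [h3]; ring
  have h1 := levelValue_succ n t n
  rw [levelValue_top] at h1
  have h2 : slope n t * chooseSum (2 * n) (n + 1) =
      t + ∑ i ∈ Finset.range (n + 1), ((2 * n).choose i : ℝ) * source n i :=
    div_mul_cancel₀ _ hH.ne'
  simp only [mul_sub, Finset.sum_sub_distrib] at hS
  rw [← Finset.sum_mul] at hS
  change _ = chooseSum (2 * n) (n + 1) * _ - _ at hS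
  rw [hq, div_mul_eq_mul_div, ← sub_eq_iff_eq_add', eq_div_iff hH.ne', hS]
  linear_combination chooseSum (2 * n) (n + 1) * (-h1) - ((2 * n).choose n : ℝ) * h2

/-! ### The recursion between levels and its link with the urn -/

/-- The expected absorption time started from `n` white and `n + 1` black balls. -/
noncomputable def tau : ℕ → ℝ
  | 0 => 0
  | n + 1 => levelValue (n + 1) (tau n) (n + 1)

lemma tau_succ (n : ℕ) : tau (n + 1) = tau n + 2 / (1 + invReturn (n + 1)) *
    ((n + 1 + 1 / 2) * oddHarmonic (n + 1) - tau n) := by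
  rw [tau, levelValue_self]; push_cast; rfl

lemma tau_nonneg (n : ℕ) : 0 ≤ tau n := by
  induction n with
  | zero => exact le_rfl
  | succ n ih => exact levelValue_nonneg ih (by omega)

/-- The expected absorption time started from `w` white and `2 * n + 1 - w` black balls. -/
noncomputable def urnValue (n w : ℕ) : ℝ := levelValue n (tau (n - 1)) w

/-- The truncated `n - 1` in `urnValue` is harmless at `n = 0`, where both sides are `0`. -/
lemma urnValue_self (n : ℕ) : urnValue n n = tau n := by
  cases n <;> rfl

/-- The expected absorption time started from a state in some `reachable N`. -/
noncomputable def stateValue (s : State) : ℝ≥0∞ := ENNReal.ofReal (urnValue ((s.1 + s.2) / 2) s.1)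

/-- The states that Policy A visits from an odd number of at most `2 * N + 1` balls. -/
def reachable (N : ℕ) : Set State := {s | ∃ n ≤ N, s.1 ≤ n ∧ s.1 + s.2 = 2 * n + 1}

lemma policyA_white {n v b : ℕ} (hb : v + 1 + b = 2 * n + 1) (hv : v < n) :
    (∃ m ≤ n, (policyA (v + 1 + 1, b - 1)).1 ≤ m ∧
      (policyA (v + 1 + 1, b - 1)).1 + (policyA (v + 1 + 1, b - 1)).2 = 2 * m + 1) ∧
    stateValue (policyA (v + 1 + 1, b - 1)) = ENNReal.ofReal (urnValue n (v + 2)) := by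
  unfold policyA
  split_ifs with h
  -- The policy intervenes only on reaching `n + 1 = v + 2` white balls; the new level is `v`, and
  -- the boundary condition of level `v + 1` is its value `tau v`.
  · obtain rfl : n = v + 1 := by dsimp only at h; omega
    obtain rfl : b = v + 2 := by omega
    refine ⟨⟨v, by omega, by dsimp only; omega, by dsimp only; omega⟩, ?_⟩
    simp only [stateValue]
    rw [show v + 2 - 1 - 1 = v by omega, show (v + (v + 2 - 1)) / 2 = v by omega, urnValue_self,
      urnValue, levelValue_top]
    rfl
  · refine ⟨⟨n, le_rfl, by dsimp only at h ⊢; omega, by dsimp only; omega⟩, ?_⟩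
    simp only [stateValue]
    rw [show (v + 1 + 1 + (b - 1)) / 2 = n by omega]

lemma policyA_black {n v b : ℕ} (hb : v + 1 + b = 2 * n + 1) (hv : v < n) :
    policyA (v + 1 - 1, b + 1) = (v, b + 1) := by
  unfold policyA
  rw [if_neg]
  · rfl
  · dsimp only; omega

lemma ae_reachable {N : ℕ} {s : State} (hs : s ∈ reachable N) :
    ∀ᵐ y ∂stepMeasure s, y ∈ reachable N := by
  obtain ⟨w, b⟩ := s
  obtain ⟨n, hn, hw, hb⟩ := hs
  dsimp only at hw hb
  unfold stepMeasure
  split_ifs with h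
  · rw [ae_dirac_iff (Set.to_countable _).measurableSet]
    exact ⟨n, hn, hw, hb⟩
  · simp only [Absorbed, not_or] at h
    obtain ⟨v, rfl⟩ : ∃ v, w = v + 1 := ⟨w - 1, by omega⟩
    rw [ae_add_measure_iff]
    refine ⟨Measure.ae_smul_measure ?_ _, Measure.ae_smul_measure ?_ _⟩ <;>
      rw [ae_dirac_iff (Set.to_countable _).measurableSet]
    · obtain ⟨m, hm, h1, h2⟩ := (policyA_white hb (by omega)).1
      exact ⟨m, hm.trans hn, h1, h2⟩
    · dsimp only
      rw [policyA_black hb (by omega)]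
      exact ⟨n, hn, by dsimp only; omega, by dsimp only; omega⟩

lemma stateValue_first_step {N : ℕ} {s : State} (hs : s ∈ reachable N) :
    stateValue s = alive s + ∫⁻ y, stateValue y ∂stepMeasure s := by
  obtain ⟨w, b⟩ := s
  obtain ⟨n, hn, hw, hb⟩ := hs
  dsimp only at hw hb
  unfold stepMeasure
  split_ifs with h
  · rw [alive_of_absorbed h, lintegral_dirac, zero_add]
  · rw [alive_of_not_absorbed h]
    simp only [Absorbed, not_or] at h
    obtain ⟨v, rfl⟩ : ∃ v, w = v + 1 := ⟨w - 1, by omega⟩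
    have hvn : v < n := by omega
    have hstep := levelValue_first_step hb hvn (tau (n - 1))
    have h0 : ∀ u ≤ n + 1, 0 ≤ urnValue n u := fun u hu => levelValue_nonneg (tau_nonneg _) hu
    rw [lintegral_add_measure, lintegral_smul_measure, lintegral_smul_measure, lintegral_dirac,
      lintegral_dirac]
    dsimp only
    rw [policyA_black hb hvn, (policyA_white hb hvn).2]
    simp only [stateValue, smul_eq_mul]
    rw [hb, show (v + (b + 1)) / 2 = n by omega, show (2 * n + 1) / 2 = n by omega]
    have hN : (0 : ℝ) < 2 * n + 1 := by positivity
    have hcast : (((v + 1 : ℕ) : ℝ≥0∞) + (b : ℝ≥0∞)) = ENNReal.ofReal (2 * n + 1) := by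
      rw [← Nat.cast_add, hb, ← ENNReal.ofReal_natCast]; push_cast; rfl
    rw [hcast, ← ENNReal.ofReal_natCast, ← ENNReal.ofReal_natCast,
      ← ENNReal.ofReal_div_of_pos hN, ← ENNReal.ofReal_div_of_pos hN,
      ← ENNReal.ofReal_mul (by positivity), ← ENNReal.ofReal_mul (by positivity),
      ← ENNReal.ofReal_add (mul_nonneg (by positivity) (h0 _ (by omega)))
        (mul_nonneg (by positivity) (h0 _ (by omega))), ← ENNReal.ofReal_one,
      ← ENNReal.ofReal_add zero_le_one (add_nonneg
        (mul_nonneg (by positivity) (h0 _ (by omega)))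
        (mul_nonneg (by positivity) (h0 _ (by omega))))]
    congr 1
    unfold urnValue
    field_simp
    push_cast
    linarith

theorem TA_self (n : ℕ) : TA (n + 1) (n + 1) = ENNReal.ofReal (tau n) := by
  have hp : policyA (n + 1, n + 1) = (n, n + 1) := by simp [policyA]
  have hval : stateValue (n, n + 1) = ENNReal.ofReal (tau n) := by
    rw [stateValue, show ((n, n + 1).1 + (n, n + 1).2) / 2 = n by dsimp only; omega, urnValue_self]
  rw [← hval, ← hp]
  refine TA_eq_of_first_step (R := reachable n)
    -- Only finitely many states matter, and a sum over all of them serves as a uniform bound.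
    (M := ∑ m ∈ Finset.range (n + 1), ∑ w ∈ Finset.range (n + 1), ENNReal.ofReal (urnValue m w))
    ?_ ?_ (fun s => ae_reachable) (fun s => stateValue_first_step) ?_
  · simp [ENNReal.sum_eq_top]
  · rw [hp]
    exact ⟨n, le_rfl, le_rfl, by dsimp only; omega⟩
  · rintro ⟨w, b⟩ ⟨m, hm, hw, hb⟩
    dsimp only at hw hb
    by_cases h : Absorbed (w, b)
    · obtain rfl : w = 0 := by
        rcases h with h | h
        · exact h
        · dsimp only at h; omega
      simp [stateValue, urnValue, levelValue_zero]
    · rw [alive_of_not_absorbed h, mul_one, stateValue]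
      dsimp only
      rw [hb, show (2 * m + 1) / 2 = m by omega]
      calc ENNReal.ofReal (urnValue m w)
          ≤ ∑ w ∈ Finset.range (n + 1), ENNReal.ofReal (urnValue m w) :=
            Finset.single_le_sum (f := fun w => ENNReal.ofReal (urnValue m w))
              (fun _ _ => zero_le) (Finset.mem_range.2 (by omega))
        _ ≤ _ := Finset.single_le_sum
            (f := fun m => ∑ w ∈ Finset.range (n + 1), ENNReal.ofReal (urnValue m w))
            (fun _ _ => zero_le) (Finset.mem_range.2 (by omega))

/-! ### Wallis bounds for `invReturn` -/

lemma invReturn_pos (n : ℕ) : 0 < invReturn n := by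
  have hC : (0 : ℝ) < ((2 * n).choose n : ℝ) := by exact_mod_cast Nat.choose_pos (by omega)
  unfold invReturn; positivity

lemma invReturn_sq (n : ℕ) : invReturn n ^ 2 = (2 * n + 1) * Real.Wallis.W n := by
  have h : (2 : ℝ) ^ (4 * n) = (4 ^ n) ^ 2 := by
    rw [show (4 : ℝ) = 2 ^ 2 by norm_num, ← pow_mul, ← pow_mul]
    congr 1; ring
  rw [Real.Wallis.W_eq_factorial_ratio, h, invReturn, two_mul n, Nat.cast_add_choose]
  field_simp

lemma invReturn_sq_le (n : ℕ) : invReturn n ^ 2 ≤ Real.pi * (n + 1 / 2) := by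
  rw [invReturn_sq]
  have := mul_le_mul_of_nonneg_left (Real.Wallis.W_le n) (show (0 : ℝ) ≤ 2 * n + 1 by positivity)
  linarith

lemma le_invReturn_sq (n : ℕ) : Real.pi * n ≤ invReturn n ^ 2 := by
  rw [invReturn_sq]
  refine le_trans ?_
    (mul_le_mul_of_nonneg_left (Real.Wallis.le_W n) (show (0 : ℝ) ≤ 2 * n + 1 by positivity))
  have hpi := Real.pi_pos
  rw [div_mul_eq_mul_div, mul_div_assoc', le_div_iff₀ (by positivity)]
  nlinarith [hpi]

lemma invReturn_succ (n : ℕ) :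
    invReturn n = invReturn (n + 1) * (1 - 1 / (2 * ((n : ℝ) + 1))) := by
  have hC : (0 : ℝ) < (n.centralBinom : ℝ) := by exact_mod_cast n.centralBinom_pos
  have hC' : (0 : ℝ) < ((n + 1).centralBinom : ℝ) := by exact_mod_cast (n + 1).centralBinom_pos
  have h : ((n : ℝ) + 1) * ((n + 1).centralBinom : ℝ) = 2 * (2 * n + 1) * n.centralBinom := by
    exact_mod_cast n.succ_mul_centralBinom_succ
  simp only [invReturn, ← Nat.centralBinom_eq_two_mul_choose]
  rw [pow_succ]
  field_simp
  linear_combination 2 * h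

lemma one_le_invReturn (n : ℕ) : 1 ≤ invReturn n := by
  induction n with
  | zero => simp [invReturn]
  | succ n ih =>
    refine ih.trans ?_
    rw [invReturn_succ n]
    have h1 := invReturn_pos (n + 1)
    have : (0 : ℝ) ≤ 1 / (2 * ((n : ℝ) + 1)) := by positivity
    nlinarith

/-- Crude, but it gives the lower bound `1 / (n + 2)` on the averaging weights. -/
lemma invReturn_le (n : ℕ) : invReturn n ≤ 2 * n + 1 := by
  cases n with
  | zero => simp [invReturn]
  | succ n =>
    have := Real.pi_le_four
    refine le_of_sq_le_sq ((invReturn_sq_le (n + 1)).trans ?_) (by positivity)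
    push_cast
    nlinarith [show (0 : ℝ) ≤ n by positivity]

/-! ### Comparison of `oddHarmonic` with the logarithm -/

lemma oddHarmonic_succ (n : ℕ) : oddHarmonic (n + 1) = oddHarmonic n + 1 / (2 * n + 1) :=
  Finset.sum_range_succ _ _

lemma oddHarmonic_nonneg (n : ℕ) : 0 ≤ oddHarmonic n :=
  Finset.sum_nonneg fun _ _ => by positivity

lemma oddHarmonic_eq (n : ℕ) : oddHarmonic n = (harmonic (2 * n) : ℝ) - (harmonic n : ℝ) / 2 := by
  induction n with
  | zero => simp [oddHarmonic]
  | succ n ih =>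
    rw [oddHarmonic_succ, ih, show 2 * (n + 1) = 2 * n + 1 + 1 by ring, harmonic_succ,
      harmonic_succ, harmonic_succ]
    push_cast
    field_simp
    ring

lemma tendsto_two_mul_oddHarmonic_sub_log :
    Tendsto (fun n : ℕ => 2 * oddHarmonic n - Real.log n) atTop
      (𝓝 (Real.log 4 + Real.eulerMascheroniConstant)) := by
  have h1 := Real.tendsto_harmonic_sub_log
  have h2 : Tendsto (fun n : ℕ => 2 * n) atTop atTop :=
    tendsto_id.const_mul_atTop' (by norm_num)
  have h3 := (((h1.comp h2).const_mul 2).sub h1).add_const (2 * Real.log 2)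
  have h4 : Real.log 4 = 2 * Real.log 2 := by
    rw [show (4 : ℝ) = 2 ^ 2 by norm_num, Real.log_pow]; norm_num
  rw [h4]
  convert h3.congr' ?_ using 2
  · ring
  · filter_upwards [eventually_gt_atTop 0] with n hn
    have : (n : ℝ) ≠ 0 := by positivity
    simp only [Function.comp, oddHarmonic_eq]
    push_cast
    rw [Real.log_mul two_ne_zero this]
    ring

/-- The error of the approximation of `2 * oddHarmonic n` by a logarithm. -/
noncomputable def logError (n : ℕ) : ℝ :=
  2 * oddHarmonic n - (Real.log n + Real.log 4 + Real.eulerMascheroniConstant)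

lemma tendsto_logError : Tendsto logError atTop (𝓝 0) := by
  have h := tendsto_two_mul_oddHarmonic_sub_log.sub_const
    (Real.log 4 + Real.eulerMascheroniConstant)
  rw [sub_self] at h
  exact h.congr fun n => by unfold logError; ring

/-- Uses `log (1 + x) ≥ 2 * x / (x + 2)` at `x = 1 / n`. Since `logError` tends to `0`, monotonicity
yields its sign. -/
lemma logError_succ_le {n : ℕ} (hn : 1 ≤ n) : logError (n + 1) ≤ logError n := by
  have hn0 : (0 : ℝ) < n := by exact_mod_cast hn
  have h := Real.le_log_one_add_of_nonneg (x := 1 / (n : ℝ)) (by positivity)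
  have hl : Real.log (1 + 1 / (n : ℝ)) = Real.log (n + 1) - Real.log n := by
    rw [← Real.log_div (by positivity) (by positivity)]; congr 1; field_simp
  have hr : 2 * (1 / (n : ℝ)) / (1 / n + 2) = 2 * (1 / (2 * n + 1)) := by
    field_simp; ring
  rw [hl, hr] at h
  simp only [logError, oddHarmonic_succ]
  push_cast
  linarith

/-- Uses `log x ≤ sinh (log x) = (x - 1 / x) / 2` at `x = (n + 1) / n`; the correction `1 / (8 * n ^
2)` telescopes and absorbs the excess. The resulting bound beats the factor `k / 2` in the
expansion. -/
lemma logError_sub_le_succ {n : ℕ} (hn : 1 ≤ n) :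
    logError n - 1 / (8 * (n : ℝ) ^ 2) ≤ logError (n + 1) - 1 / (8 * ((n + 1 : ℕ) : ℝ) ^ 2) := by
  have hn0 : (0 : ℝ) < n := by exact_mod_cast hn
  have hx : (0 : ℝ) < (n + 1) / n := by positivity
  have hl : Real.log ((n + 1) / (n : ℝ)) = Real.log (n + 1) - Real.log n :=
    Real.log_div (by positivity) (by positivity)
  have h := Real.self_le_sinh_iff.2 (Real.log_nonneg (x := ((n : ℝ) + 1) / n)
    (by rw [le_div_iff₀ hn0]; linarith))
  rw [Real.sinh_log hx, hl] at h
  have key : (((n : ℝ) + 1) / n - (((n : ℝ) + 1) / n)⁻¹) / 2 ≤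
      2 * (1 / (2 * n + 1)) + 1 / (8 * (n : ℝ) ^ 2) - 1 / (8 * ((n : ℝ) + 1) ^ 2) := by
    have : 2 * (1 / (2 * n + 1)) + 1 / (8 * (n : ℝ) ^ 2) - 1 / (8 * ((n : ℝ) + 1) ^ 2) -
        (((n : ℝ) + 1) / n - (((n : ℝ) + 1) / n)⁻¹) / 2 =
        1 / (8 * (2 * n + 1) * n ^ 2 * (n + 1) ^ 2) := by
      field_simp; ring
    have h2 : (0 : ℝ) ≤ 1 / (8 * (2 * n + 1) * n ^ 2 * (n + 1) ^ 2) := by positivity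
    linarith
  simp only [logError, oddHarmonic_succ]
  push_cast
  linarith

lemma logError_nonneg (n : ℕ) : 0 ≤ logError (n + 1) := by
  have hanti : Antitone fun n => logError (n + 1) :=
    antitone_nat_of_succ_le fun n => logError_succ_le (by omega)
  exact hanti.le_of_tendsto ((tendsto_add_atTop_iff_nat 1).2 tendsto_logError) n

lemma logError_le (n : ℕ) : logError (n + 1) ≤ 1 / (8 * ((n : ℝ) + 1) ^ 2) := by
  have hmono : Monotone fun n : ℕ => logError (n + 1) - 1 / (8 * ((n + 1 : ℕ) : ℝ) ^ 2) :=
    monotone_nat_of_le_succ fun n => logError_sub_le_succ (by omega)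
  have hz : Tendsto (fun n : ℕ => 1 / (8 * (n : ℝ) ^ 2)) atTop (𝓝 0) := by
    refine tendsto_const_nhds.div_atTop (Tendsto.const_mul_atTop (by norm_num) ?_)
    exact (tendsto_pow_atTop two_ne_zero).comp tendsto_natCast_atTop_atTop
  have hlim := (tendsto_add_atTop_iff_nat 1).2 (tendsto_logError.sub hz)
  have := hmono.ge_of_tendsto hlim n
  push_cast at this
  linarith

/-! ### Contraction of errors under averaging -/

/-- Iterated averages with weights `q n ≥ 1 / (n + 2)` inherit the limit of the averaged
sequence. -/
lemma tendsto_zero_of_average {E q r : ℕ → ℝ} (hq : ∀ n : ℕ, 1 / ((n : ℝ) + 2) ≤ q n)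
    (hq1 : ∀ n, q n ≤ 1) (hE : ∀ n, E (n + 1) = (1 - q n) * E n + q n * r n)
    (hr : Tendsto r atTop (𝓝 0)) : Tendsto E atTop (𝓝 0) := by
  rw [Metric.tendsto_atTop] at hr ⊢
  intro ε hε
  obtain ⟨N, hN⟩ := hr (ε / 2) (by positivity)
  simp only [Real.dist_eq, sub_zero] at hN ⊢
  -- The excess of `|E n|` over `ε / 2` shrinks by at least the factor `1 - 1 / (n + 2) = (n + 1) /
  -- (n + 2)`, so `n + 1` times the excess does not increase.
  have hstep : ∀ n ≥ N, (((n + 1 : ℕ) : ℝ) + 1) * max (|E (n + 1)| - ε / 2) 0 ≤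
      ((n : ℝ) + 1) * max (|E n| - ε / 2) 0 := by
    intro n hn
    have hqn : 0 ≤ q n := le_trans (by positivity) (hq n)
    have h1 : |E (n + 1)| ≤ (1 - q n) * |E n| + q n * (ε / 2) := by
      rw [hE]
      refine (abs_add_le _ _).trans ?_
      rw [abs_mul, abs_mul, abs_of_nonneg hqn, abs_of_nonneg (sub_nonneg.2 (hq1 n))]
      gcongr
      exact (hN n hn).le
    have h2 : max (|E (n + 1)| - ε / 2) 0 ≤ (1 - q n) * max (|E n| - ε / 2) 0 := by
      refine max_le ?_ (mul_nonneg (sub_nonneg.2 (hq1 n)) (le_max_right _ _))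
      have := mul_le_mul_of_nonneg_left (le_max_left (|E n| - ε / 2) 0) (sub_nonneg.2 (hq1 n))
      linarith
    have h3 : 1 - q n ≤ ((n : ℝ) + 1) / (n + 2) := by
      have := hq n
      have h4 : ((n : ℝ) + 1) / (n + 2) = 1 - 1 / (n + 2) := by field_simp; ring
      linarith
    have h5 := h2.trans (mul_le_mul_of_nonneg_right h3 (le_max_right (|E n| - ε / 2) 0))
    rw [div_mul_eq_mul_div, le_div_iff₀ (by positivity)] at h5
    push_cast
    linarith
  set K := ((N : ℝ) + 1) * max (|E N| - ε / 2) 0 with hK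
  have hbound : ∀ n ≥ N, ((n : ℝ) + 1) * max (|E n| - ε / 2) 0 ≤ K := by
    intro n hn
    induction n, hn using Nat.le_induction with
    | base => exact le_rfl
    | succ n hn ih => exact (hstep n hn).trans ih
  obtain ⟨N', hN'⟩ := exists_nat_gt (K / (ε / 2))
  refine ⟨max N N', fun n hn => ?_⟩
  have h1 := hbound n (le_trans (le_max_left _ _) hn)
  have h2 : (N' : ℝ) ≤ n := by exact_mod_cast le_trans (le_max_right _ _) hn
  have h3 : K < (n + 1) * (ε / 2) := by
    rw [div_lt_iff₀ (by positivity)] at hN'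
    nlinarith
  have h4 : max (|E n| - ε / 2) 0 < ε / 2 := lt_of_mul_lt_mul_left (h1.trans_lt h3) (by positivity)
  have := (le_max_left _ _).trans_lt h4
  linarith

/-! ### Limits of the error terms -/

lemma tendsto_sqrt_succ : Tendsto (fun n : ℕ => √((n : ℝ) + 1)) atTop atTop :=
  Real.tendsto_sqrt_atTop.comp
    (tendsto_atTop_add_const_right _ _ tendsto_natCast_atTop_atTop)

lemma tendsto_inv_sqrt_succ : Tendsto (fun n : ℕ => (√((n : ℝ) + 1))⁻¹) atTop (𝓝 0) :=
  tendsto_inv_atTop_zero.comp tendsto_sqrt_succ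

lemma tendsto_oddHarmonic_div_sqrt :
    Tendsto (fun n : ℕ => oddHarmonic (n + 1) / √((n : ℝ) + 1)) atTop (𝓝 0) := by
  have hlog : Tendsto (fun x : ℝ => Real.log x / √x) atTop (𝓝 0) := by
    have := (isLittleO_log_rpow_atTop (show (0 : ℝ) < 1 / 2 by norm_num)).tendsto_div_nhds_zero
    exact this.congr fun x => by rw [Real.sqrt_eq_rpow]
  have hlog' : Tendsto (fun n : ℕ => Real.log ((n + 1 : ℕ) : ℝ) / √((n + 1 : ℕ) : ℝ)) atTop (𝓝 0) :=
    (tendsto_add_atTop_iff_nat 1).2 (hlog.comp tendsto_natCast_atTop_atTop)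
  have h := (((((tendsto_add_atTop_iff_nat 1).2 tendsto_two_mul_oddHarmonic_sub_log).mul
    tendsto_inv_sqrt_succ).add hlog').div_const 2)
  simp only [mul_zero, add_zero, zero_div] at h
  refine h.congr fun n => ?_
  push_cast
  have : √((n : ℝ) + 1) ≠ 0 := by positivity
  field_simp
  ring

lemma abs_invReturn_sq_div_sub_pi (n : ℕ) :
    |invReturn (n + 1) ^ 2 / ((n : ℝ) + 1) - Real.pi| ≤ Real.pi / (2 * ((n : ℝ) + 1)) := by
  have h1 := invReturn_sq_le (n + 1)
  have h2 := le_invReturn_sq (n + 1)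
  push_cast at h1 h2
  have hn : (0 : ℝ) < (n : ℝ) + 1 := by positivity
  have hpi := Real.pi_pos
  have h3 : Real.pi ≤ invReturn (n + 1) ^ 2 / ((n : ℝ) + 1) := by rwa [le_div_iff₀ hn]
  rw [abs_of_nonneg (by linarith), sub_le_iff_le_add, div_le_iff₀ hn]
  refine h1.trans (le_of_eq ?_)
  field_simp
  ring

/-- The factor `√(n + 1)` leaves room for a later multiplication by `oddHarmonic`, which is of
smaller order. -/
lemma tendsto_sqrt_mul_invReturn_sq_div_sub_pi :
    Tendsto (fun n : ℕ => √((n : ℝ) + 1) * (invReturn (n + 1) ^ 2 / ((n : ℝ) + 1) - Real.pi))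
      atTop (𝓝 0) := by
  have h := tendsto_inv_sqrt_succ.const_mul (Real.pi / 2)
  rw [mul_zero] at h
  refine squeeze_zero_norm (fun n => ?_) h
  rw [Real.norm_eq_abs, abs_mul, abs_of_nonneg (Real.sqrt_nonneg _)]
  refine (mul_le_mul_of_nonneg_left (abs_invReturn_sq_div_sub_pi n) (Real.sqrt_nonneg _)).trans
    (le_of_eq ?_)
  have h0 : √((n : ℝ) + 1) ≠ 0 := by positivity
  have hs : √((n : ℝ) + 1) ^ 2 = (n : ℝ) + 1 := Real.sq_sqrt (by positivity)
  rw [← hs]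
  rw [Real.sqrt_sq (Real.sqrt_nonneg _)]
  field_simp

lemma tendsto_invReturn_sq_div :
    Tendsto (fun n : ℕ => invReturn (n + 1) ^ 2 / ((n : ℝ) + 1)) atTop (𝓝 Real.pi) := by
  have h := (tendsto_sqrt_mul_invReturn_sq_div_sub_pi.mul tendsto_inv_sqrt_succ).add_const Real.pi
  rw [mul_zero, zero_add] at h
  refine h.congr fun n => ?_
  have h0 : √((n : ℝ) + 1) ≠ 0 := by positivity
  field_simp
  ring

lemma tendsto_invReturn_div_sqrt :
    Tendsto (fun n : ℕ => invReturn (n + 1) / √((n : ℝ) + 1)) atTop (𝓝 √Real.pi) := by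
  refine ((Real.continuous_sqrt.tendsto _).comp tendsto_invReturn_sq_div).congr fun n => ?_
  simp only [Function.comp]
  rw [Real.sqrt_div (by positivity), Real.sqrt_sq (invReturn_pos _).le]

lemma tendsto_invReturn_div :
    Tendsto (fun n : ℕ => invReturn (n + 1) / ((n : ℝ) + 1)) atTop (𝓝 0) := by
  have h := tendsto_invReturn_div_sqrt.mul tendsto_inv_sqrt_succ
  rw [mul_zero] at h
  refine h.congr fun n => ?_
  have hs : √((n : ℝ) + 1) ^ 2 = (n : ℝ) + 1 := Real.sq_sqrt (by positivity)
  nth_rw 3 [← hs]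
  rw [div_mul_eq_mul_div, sq, div_mul_eq_div_div, div_eq_mul_inv (invReturn _)]

lemma tendsto_oddHarmonic_mul_invReturn_div :
    Tendsto (fun n : ℕ => oddHarmonic (n + 1) * (invReturn (n + 1) / ((n : ℝ) + 1))) atTop
      (𝓝 0) := by
  have h := tendsto_oddHarmonic_div_sqrt.mul tendsto_invReturn_div_sqrt
  rw [zero_mul] at h
  refine h.congr fun n => ?_
  have hs : √((n : ℝ) + 1) ^ 2 = (n : ℝ) + 1 := Real.sq_sqrt (by positivity)
  nth_rw 3 [← hs]
  rw [div_mul_div_comm, sq, mul_div_assoc]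

lemma tendsto_oddHarmonic_mul_sub_pi :
    Tendsto (fun n : ℕ => oddHarmonic (n + 1) *
      (invReturn (n + 1) ^ 2 / ((n : ℝ) + 1) - Real.pi)) atTop (𝓝 0) := by
  have h := tendsto_oddHarmonic_div_sqrt.mul tendsto_sqrt_mul_invReturn_sq_div_sub_pi
  rw [zero_mul] at h
  refine h.congr fun n => ?_
  have h0 : √((n : ℝ) + 1) ≠ 0 := by positivity
  field_simp

lemma tendsto_inv_odd : Tendsto (fun n : ℕ => 1 / (2 * (n : ℝ) + 1)) atTop (𝓝 0) :=
  tendsto_const_nhds.div_atTop (tendsto_atTop_add_const_right _ _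
    (tendsto_natCast_atTop_atTop.const_mul_atTop two_pos))

lemma tendsto_invReturn_div_odd :
    Tendsto (fun n : ℕ => invReturn (n + 1) / (2 * (n : ℝ) + 1)) atTop (𝓝 0) := by
  refine squeeze_zero (fun n => div_nonneg (invReturn_pos _).le (by positivity)) (fun n => ?_)
    tendsto_invReturn_div
  exact div_le_div_of_nonneg_left (invReturn_pos _).le (by positivity)
    (by linarith [show (0 : ℝ) ≤ n by positivity])

/-! ### The approximate solution of the recursion -/

/-- An approximation of `tau` in terms of `oddHarmonic` and `invReturn`. -/
noncomputable def tauApprox (n : ℕ) : ℝ :=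
  (n + 1 + Real.pi / 8 - invReturn n / 2) * oddHarmonic n - invReturn n / 4 + 3 * Real.pi / 16 +
    1 / 4

/-- The defect of `tauApprox` in the recursion of `tau`. -/
noncomputable def tauDefect (n : ℕ) : ℝ :=
  1 / 8 * (oddHarmonic (n + 1) * (invReturn (n + 1) ^ 2 / ((n : ℝ) + 1) - Real.pi)) -
    1 / 8 * (oddHarmonic (n + 1) * (invReturn (n + 1) / ((n : ℝ) + 1))) +
    3 / 16 * (invReturn (n + 1) ^ 2 / ((n : ℝ) + 1) - Real.pi) +
    (1 / 4 + Real.pi / 16) * (1 / (2 * (n : ℝ) + 1)) -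
    3 / 16 * (invReturn (n + 1) / ((n : ℝ) + 1)) -
    (1 / 4 + Real.pi / 16) * (invReturn (n + 1) / (2 * (n : ℝ) + 1))

lemma tendsto_tauDefect : Tendsto tauDefect atTop (𝓝 0) := by
  have h := (((((tendsto_oddHarmonic_mul_sub_pi.const_mul (1 / 8)).sub
    (tendsto_oddHarmonic_mul_invReturn_div.const_mul (1 / 8))).add
    ((tendsto_invReturn_sq_div.sub_const Real.pi).const_mul (3 / 16))).add
    (tendsto_inv_odd.const_mul (1 / 4 + Real.pi / 16))).sub
    (tendsto_invReturn_div.const_mul (3 / 16))).sub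
    (tendsto_invReturn_div_odd.const_mul (1 / 4 + Real.pi / 16))
  simp only [mul_zero, sub_self, add_zero] at h
  exact h

/-- The coefficients of `tauApprox` come from iterating `f n = (n + 3/2) * oddHarmonic (n + 1) - (1
+ a) / 2 * (f (n + 1) - f n)`, with `a = invReturn (n + 1)`, up to vanishing terms. The first pass
gives `-a / 2 * oddHarmonic - a / 4`; the second gives the terms in `π`, through `a ^ 2 / n → π`. -/
lemma tauApprox_succ (n : ℕ) :
    (n + 1 + 1 / 2) * oddHarmonic (n + 1) - tauApprox n -
      (tauApprox (n + 1) - tauApprox n) * ((1 + invReturn (n + 1)) / 2) = tauDefect n := by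
  have hO : oddHarmonic n = oddHarmonic (n + 1) - 1 / (2 * n + 1) := by
    rw [oddHarmonic_succ]; ring
  simp only [tauApprox, tauDefect]
  rw [hO, invReturn_succ n]
  generalize oddHarmonic (n + 1) = O
  generalize invReturn (n + 1) = a
  push_cast
  field_simp
  ring

lemma tendsto_tau_sub_tauApprox : Tendsto (fun n => tau n - tauApprox n) atTop (𝓝 0) := by
  have ha := fun n => invReturn_pos (n + 1)
  refine tendsto_zero_of_average (q := fun n => 2 / (1 + invReturn (n + 1))) (r := tauDefect)
    (fun n => ?_) (fun n => ?_) (fun n => ?_) tendsto_tauDefect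
  · have := ha n
    have h := invReturn_le (n + 1)
    push_cast at h
    rw [div_le_div_iff₀ (by positivity) (by positivity)]
    linarith
  · have := ha n
    have h := one_le_invReturn (n + 1)
    rw [div_le_one (by positivity)]
    linarith
  · have := ha n
    rw [← tauApprox_succ, tau_succ]
    field_simp
    ring

/-! ### Passage to the explicit expansion -/

/-- The asymptotic expansion of the expected absorption time. -/
noncomputable def expansion (k : ℝ) : ℝ :=
  (k / 2 + Real.pi / 16 - √(Real.pi * k) / 4) *
      (Real.log k + Real.log 4 + Real.eulerMascheroniConstant) +
    3 * Real.pi / 16 - √(Real.pi * k) / 4 - 1 / 4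

lemma sqrt_sub_invReturn_nonneg (n : ℕ) : 0 ≤ √(Real.pi * ((n : ℝ) + 1)) - invReturn n := by
  have hpi := Real.pi_pos
  rw [sub_nonneg]
  refine Real.le_sqrt_of_sq_le ((invReturn_sq_le n).trans ?_)
  gcongr
  norm_num

/-- The squares differ by at most `π`; divide by the sum of the roots, which is at least `√(π * (n +
1))`. -/
lemma sqrt_sub_invReturn_le (n : ℕ) :
    √(Real.pi * ((n : ℝ) + 1)) - invReturn n ≤ √Real.pi * (√((n : ℝ) + 1))⁻¹ := by
  have hpi := Real.pi_pos
  have h1 := le_invReturn_sq n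
  have h2 := invReturn_pos n
  have h3 := sqrt_sub_invReturn_nonneg n
  have hs : √(Real.pi * ((n : ℝ) + 1)) ^ 2 = Real.pi * ((n : ℝ) + 1) :=
    Real.sq_sqrt (by positivity)
  have hp : √Real.pi ^ 2 = Real.pi := Real.sq_sqrt hpi.le
  have h4 : √(Real.pi * ((n : ℝ) + 1)) = √Real.pi * √((n : ℝ) + 1) := Real.sqrt_mul hpi.le _
  have h5 : 0 < √((n : ℝ) + 1) := by positivity
  have h6 : 0 < √Real.pi := by positivity
  rw [← div_eq_mul_inv, le_div_iff₀ h5]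
  refine le_of_mul_le_mul_left ?_ h6
  rw [mul_comm _ (√((n : ℝ) + 1)), ← mul_assoc, ← h4]
  nlinarith

/-- With `k = n + 1`, the critical errors are `oddHarmonic` times `√(π * k) - invReturn n` and `k *
logError k`. The constant `1/4` becomes `-1/4` because replacing `oddHarmonic n` by `oddHarmonic (n
+ 1)` costs `(n + 1) / (2 * n + 1) → 1/2`. -/
lemma tendsto_tauApprox_sub_expansion :
    Tendsto (fun n : ℕ => tauApprox n - expansion ((n : ℝ) + 1)) atTop (𝓝 0) := by
  have hd : Tendsto (fun n : ℕ => √(Real.pi * ((n : ℝ) + 1)) - invReturn n) atTop (𝓝 0) := by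
    refine squeeze_zero sqrt_sub_invReturn_nonneg sqrt_sub_invReturn_le ?_
    simpa using tendsto_inv_sqrt_succ.const_mul √Real.pi
  have hOd : Tendsto (fun n : ℕ => oddHarmonic (n + 1) *
      (√(Real.pi * ((n : ℝ) + 1)) - invReturn n)) atTop (𝓝 0) := by
    refine squeeze_zero (fun n => mul_nonneg (oddHarmonic_nonneg _) (sqrt_sub_invReturn_nonneg n))
      (fun n => mul_le_mul_of_nonneg_left (sqrt_sub_invReturn_le n) (oddHarmonic_nonneg _)) ?_
    have := tendsto_oddHarmonic_div_sqrt.const_mul √Real.pi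
    rw [mul_zero] at this
    exact this.congr fun n => by ring
  have hk : Tendsto (fun n : ℕ => ((n : ℝ) + 1) * logError (n + 1)) atTop (𝓝 0) := by
    refine squeeze_zero (fun n => mul_nonneg (by positivity) (logError_nonneg n)) (fun n => ?_)
      (tendsto_one_div_add_atTop_nhds_zero_nat (𝕜 := ℝ))
    refine (mul_le_mul_of_nonneg_left (logError_le n) (by positivity)).trans ?_
    rw [mul_one_div, div_le_div_iff₀ (by positivity) (by positivity)]
    nlinarith [sq_nonneg ((n : ℝ) + 1)]
  have hsk : Tendsto (fun n : ℕ => √((n : ℝ) + 1) * logError (n + 1)) atTop (𝓝 0) := by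
    refine squeeze_zero (fun n => mul_nonneg (by positivity) (logError_nonneg n)) (fun n => ?_) hk
    refine mul_le_mul_of_nonneg_right ?_ (logError_nonneg n)
    rw [Real.sqrt_le_left (by positivity)]
    nlinarith [show (0 : ℝ) ≤ n by positivity]
  have hl := (tendsto_add_atTop_iff_nat 1).2 tendsto_logError
  have h := (((((hOd.const_mul (1 / 2)).sub (tendsto_inv_odd.const_mul (1 / 2 + Real.pi / 8))).add
    ((tendsto_invReturn_div).const_mul (1 / 4))).add (hd.const_mul (1 / 4))).add
    (hk.const_mul (1 / 2))).add ((hl.const_mul (Real.pi / 16)).sub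
    (hsk.const_mul (√Real.pi / 4)))
  simp only [mul_zero, add_zero, sub_zero] at h
  refine h.congr fun n => ?_
  have hO : oddHarmonic n = oddHarmonic (n + 1) - 1 / (2 * n + 1) := by
    rw [oddHarmonic_succ]; ring
  have hL : Real.log ((n : ℝ) + 1) + Real.log 4 + Real.eulerMascheroniConstant =
      2 * oddHarmonic (n + 1) - logError (n + 1) := by
    simp only [logError]; push_cast; ring
  have h4 : √(Real.pi * ((n : ℝ) + 1)) = √Real.pi * √((n : ℝ) + 1) :=
    Real.sqrt_mul Real.pi_pos.le _
  simp only [expansion, tauApprox]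
  rw [hL, hO, invReturn_succ n, h4]
  generalize oddHarmonic (n + 1) = O
  generalize invReturn (n + 1) = a
  generalize logError (n + 1) = e
  generalize √((n : ℝ) + 1) = s
  generalize √Real.pi = p
  field_simp
  ring

lemma tendsto_tau_sub_expansion :
    Tendsto (fun n : ℕ => tau n - expansion ((n : ℝ) + 1)) atTop (𝓝 0) := by
  have h := tendsto_tau_sub_tauApprox.add tendsto_tauApprox_sub_expansion
  rw [add_zero] at h
  exact h.congr fun n => by ring

end Mabinogion

theorem theorem1 :
    (∀ k : ℕ, 1 ≤ k → Mabinogion.TA k k ≠ ∞) ∧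
    Tendsto (fun k : ℕ =>
      (Mabinogion.TA k k).toReal -
        (((k : ℝ) / 2 + Real.pi / 16 - Real.sqrt (Real.pi * k) / 4) *
            (Real.log k + Real.log 4 + Real.eulerMascheroniConstant) +
          3 * Real.pi / 16 - Real.sqrt (Real.pi * k) / 4 - 1 / 4))
      atTop (𝓝 0) := by
  refine ⟨fun k hk => ?_, (tendsto_add_atTop_iff_nat 1).1 ?_⟩
  · obtain ⟨n, rfl⟩ : ∃ n, k = n + 1 := ⟨k - 1, by omega⟩
    rw [Mabinogion.TA_self]
    exact ENNReal.ofReal_ne_top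
  · refine Mabinogion.tendsto_tau_sub_expansion.congr fun n => ?_
    rw [Mabinogion.TA_self, ENNReal.toReal_ofReal (Mabinogion.tau_nonneg n),
      Mabinogion.expansion]
    push_cast
    rfl
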